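/- A metric space $(X,d)$ with a Borel measure $\mu$, $\mu(X)>0$, is a space of homogeneous type if there is $C_D<\infty$ with $0<\mu(B(x,2r))\le C_D\,\mu(B(x,r))<\infty$ for all $x\in X$, $r>0$, where $B(x,r)$ is the open ball. For a ball $B=B(z,r)$ and $\varepsilon>0$ let $$B_\varepsilon=\{x\in B: d(x,B^c)\le\varepsilon\}\cup\{y\in B^c: d(y,B)\le\varepsilon\}$$ (with $d(x,\varnothing)=+\infty$). The space has the layer decay property (LD) if there are $\eta>0$, $C<\infty$ such that, for every ball $B=B(z,r)$ and every $\varepsilon>0$, $$\mu(B_\varepsilon)\le C\left(\frac{\varepsilon}{r}\right)^{\eta}\mu(B).\qquad(1)$$ Put $\lambda(x,y)=\mu(B(x,d(x,y)))$ and $2B=B(z,2r)$. For $1<\nu<\infty$ and $\nu'=\nu/(\nu-1)$, the Hardy inequality with exponent $\nu$ and constant $C$ holds on $B$ if $$\int_B\int_{2B\setminus B}\frac{|f(y)g(x)|}{\lambda(x,y)}\,d\mu(x)\,d\mu(y)\le C\,\|f\|_{L^\nu}\|g\|_{L^{\nu'}}\qquad(2)$$ for all $f\in L^\nu$ vanishing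 outside $B$ and all $g\in L^{\nu'}$ vanishing outside $2B\setminus B$. The space has the Hardy property (HP) if for every $1<\nu<\infty$ there is $C<\infty$ such that (2) holds on every ball. Let $\epsilon_1(t)=e^{-1/t^2}\sin\!\left(\pi e^{1/t-1/\pi}\right)$ for $0<t<\pi$, and let $X_1=\{\gamma(t): t\ge-1\}\subset\mathbb C$, where $\gamma(t)=t+1$ for $-1\le t\le0$, $\gamma(t)=(1+\epsilon_1(t))e^{it}$ for $0<t<\pi$, and $\gamma(t)=\pi-t$ for $t\ge\pi$. Equip $X_1$ with the Euclidean distance and the one-dimensional Hausdorff measure $\Lambda$. Let $B^0$ be the ball of $X_1$ with centre $0$ and radius $1$. Then $(X_1,d,\Lambda)$ is a space of homogeneous type, and: 1. There is $c>0$ such that $\Lambda(B^0_\varepsilon)\ge c/|\ln\varepsilon|$ for all $0<\varepsilon\le 1/2$. Consequently, for no $\eta>0$ and $C<\infty$ does (1) hold on $B^0$ for all $\varepsilon>0$; in particular $X_1$ does not satisfy (LD). 2. For every $1<\nu<\infty$ there is no $C<\infty$ for which (2) holds on $B^0$; in particular, for every $1<\nu<\infty$, no constant works in (2) for all balls, and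 $X_1$ does not satisfy (HP). -/

import Mathlib

open MeasureTheory
open scoped ENNReal NNReal

noncomputable section

namespace HomogeneousType

/-! ### Spaces of homogeneous type, layer decay and the Hardy property

Here `X` is a metric space with a Borel measure `μ`, and `Metric.ball z r` is the open ball. -/

section General

variable {X : Type*} [MetricSpace X] [MeasurableSpace X] [BorelSpace X]

/-- `(X, d, μ)` is a space of homogeneous type: `μ(X) > 0` and there is a finite constant `C` with
`0 < μ(B(x,2r)) ≤ C μ(B(x,r)) < ∞` for all `x` and all `r > 0`. -/
def IsHomogeneousType (μ : Measure X) : Prop :=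
  0 < μ Set.univ ∧
    ∃ C : ℝ≥0, ∀ (x : X) (r : ℝ), 0 < r →
      0 < μ (Metric.ball x (2 * r)) ∧
      μ (Metric.ball x (2 * r)) ≤ C * μ (Metric.ball x r) ∧
      C * μ (Metric.ball x r) < ∞

/-- The union `B_ε` of the inner and outer layers of the ball `B = B(z,r)`:
the points of `B` at distance at most `ε` from the complement of `B`, together with the points of
the complement at distance at most `ε` from `B`. The distance to the empty set is `∞`. -/
def layer (z : X) (r ε : ℝ) : Set X :=
  {x | x ∈ Metric.ball z r ∧ Metric.infEDist x (Metric.ball z r)ᶜ ≤ ENNReal.ofReal ε} ∪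
  {y | y ∈ (Metric.ball z r)ᶜ ∧ Metric.infEDist y (Metric.ball z r) ≤ ENNReal.ofReal ε}

/-- The layer decay inequality `μ(B_ε) ≤ C (ε/r)^η μ(B)`, for all `ε > 0`,
on the single ball `B = B(z,r)`. -/
def LayerDecayOnBall (μ : Measure X) (z : X) (r η : ℝ) (C : ℝ≥0) : Prop :=
  ∀ ε : ℝ, 0 < ε →
    μ (layer z r ε) ≤ C * ENNReal.ofReal ((ε / r) ^ η) * μ (Metric.ball z r)

/-- The layer decay property (LD). -/
def LayerDecay (μ : Measure X) : Prop :=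
  ∃ η : ℝ, 0 < η ∧ ∃ C : ℝ≥0, ∀ (z : X) (r : ℝ), 0 < r → LayerDecayOnBall μ z r η C

/-- `λ(x,y) = μ(B(x, d(x,y)))`. -/
def vol (μ : Measure X) (x y : X) : ℝ≥0∞ := μ (Metric.ball x (dist x y))

/-- The Hardy inequality with exponents `ν`, `ν' = ν / (ν - 1)` and constant `C` on the single
ball `B = B(z,r)`, for all `f ∈ L^ν` supported on `B` and `g ∈ L^ν'` supported on `2B \ B`. -/
def HardyOnBall (μ : Measure X) (z : X) (r ν : ℝ) (C : ℝ≥0) : Prop :=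
  ∀ f g : X → ℂ,
    Function.support f ⊆ Metric.ball z r →
    Function.support g ⊆ Metric.ball z (2 * r) \ Metric.ball z r →
    MemLp f (ENNReal.ofReal ν) μ →
    MemLp g (ENNReal.ofReal (ν / (ν - 1))) μ →
    ∫⁻ y in Metric.ball z r, ∫⁻ x in Metric.ball z (2 * r) \ Metric.ball z r,
        ‖f y * g x‖ₑ / vol μ x y ∂μ ∂μ
      ≤ C * eLpNorm f (ENNReal.ofReal ν) μ * eLpNorm g (ENNReal.ofReal (ν / (ν - 1))) μ

/-- The Hardy inequality for one exponent `ν`, with a constant uniform over all balls. -/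
def HardyForExponent (μ : Measure X) (ν : ℝ) : Prop :=
  ∃ C : ℝ≥0, ∀ (z : X) (r : ℝ), 0 < r → HardyOnBall μ z r ν C

/-- The Hardy property (HP): the Hardy inequality holds for every `1 < ν < ∞`. -/
def HardyProperty (μ : Measure X) : Prop :=
  ∀ ν : ℝ, 1 < ν → HardyForExponent μ ν

end General

/-! ### The curve -/

/-- The curve made of the segment `[0,1]`, the upper unit half-circle with radius perturbed to
`1 + ε(t)`, and the half-line `]-∞,-1]`; its parameter ranges over `t ≥ -1`. -/
def curve (ε : ℝ → ℝ) (t : ℝ) : ℂ :=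
  if t ≤ 0 then ⟨t + 1, 0⟩
  else if t < Real.pi then ⟨(1 + ε t) * Real.cos t, (1 + ε t) * Real.sin t⟩
  else ⟨Real.pi - t, 0⟩

/-- The image `X_ε` of the curve. -/
def curveSpace (ε : ℝ → ℝ) : Set ℂ := curve ε '' Set.Ici (-1)

/-- `ε₁(t) = exp(-1/t²) sin(π exp(1/t - 1/π))`. -/
def eps₁ (t : ℝ) : ℝ :=
  Real.exp (-(1 / t ^ 2)) * Real.sin (Real.pi * Real.exp (1 / t - 1 / Real.pi))

/-- The space `X₁`, with the distance induced by `ℂ`. -/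
abbrev X₁ : Type := curveSpace eps₁

/-- Hausdorff length on `X₁`. -/
def length₁ : Measure X₁ := μH[1]

theorem zero_mem_curveSpace (ε : ℝ → ℝ) : (0 : ℂ) ∈ curveSpace ε :=
  ⟨-1, by simp, by
    rw [curve, if_pos (by norm_num)]
    apply Complex.ext <;> simp⟩

/-- The origin, as a point of `X₁`; the unit ball is `Metric.ball origin₁ 1`. -/
def origin₁ : X₁ := ⟨0, zero_mem_curveSpace eps₁⟩

end HomogeneousType

end

namespace HomogeneousType

/-! ### Hausdorff length of connected sets and of bi-Lipschitz arcs -/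

section HausdorffLength

variable {Y : Type*} [MetricSpace Y] [MeasurableSpace Y] [BorelSpace Y]

/-! Put u = exp(1/t - 1/π). The sign of sin(πu) decides the side of the unit circle, so the arc
alternates between outer pieces, u in [2j, 2j+1], and inner pieces, u in ]2j+1, 2j+2[. The
wavelength in t is about t² exp(-1/t), while the amplitude exp(-1/t²) is far smaller. The arc is
therefore bi-Lipschitz to an interval, and balls have length at most `K * r`; connectedness and
unboundedness give the lower bound `r`, whence doubling.

Layers: every point of parameter t is within O(exp(-1/t)) of both sides (`exists_point₁_near`), so
the ε-layer contains all parameters up to about 1/|ln ε|. This decays more slowly than any power of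
ε.

Hardy: on a block u in [2m, 8m] the curve in the variable u is bi-Lipschitz up to one scale a,
uniformly in m (`exists_dist_point₁_param_bounds`). With f and g the indicators of m inner and 2m
outer pieces, a pair whose indices differ by l contributes at least a constant times a/(l+1). The
double integral is at least of order a m (1 + 1/2 + ... + 1/m), whereas the product of norms is O(a
m) for every exponent. The harmonic series diverges, so no constant works. -/

theorem volume_dist_image_le (x : Y) (S : Set Y) :
    volume ((fun y => dist x y) '' S) ≤ μH[1] S := by
  have h : LipschitzOnWith 1 (fun y => dist x y) S := (LipschitzWith.dist_right x).lipschitzOnWith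
  simpa [hausdorffMeasure_real] using h.hausdorffMeasure_image_le (d := 1) zero_le_one

/-- A connected set is at least as long as the distance between any two of its points. -/
theorem ofReal_dist_le_hausdorffMeasure {S : Set Y} (hS : IsPreconnected S) {x y : Y}
    (hx : x ∈ S) (hy : y ∈ S) : ENNReal.ofReal (dist x y) ≤ μH[1] S := by
  refine le_trans ?_ (volume_dist_image_le x S)
  have h := (hS.image (fun y => dist x y) (by fun_prop)).Icc_subset
    (a := 0) (b := dist x y) ⟨x, hx, dist_self x⟩ ⟨y, hy, rfl⟩
  simpa using measure_mono (μ := volume) h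

/-- In an unbounded connected space, balls are at least as long as their radius. -/
theorem ofReal_le_hausdorffMeasure_ball [PreconnectedSpace Y] (x : Y)
    (hub : ∀ r : ℝ, ∃ y, r ≤ dist x y) (r : ℝ) :
    ENNReal.ofReal r ≤ μH[1] (Metric.ball x r) := by
  refine le_trans ?_ (volume_dist_image_le x _)
  obtain ⟨y, hy⟩ := hub r
  have h := (isPreconnected_univ.image (fun y => dist x y) (by fun_prop)).Icc_subset
    (a := 0) (b := dist x y) ⟨x, trivial, dist_self x⟩ ⟨y, trivial, rfl⟩
  have h' : Set.Ico 0 r ⊆ (fun y => dist x y) '' Metric.ball x r := by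
    rintro s ⟨hs0, hsr⟩
    obtain ⟨z, -, hz⟩ := h ⟨hs0, hsr.le.trans hy⟩
    exact ⟨z, Metric.mem_ball'.2 (hz.trans_lt hsr), hz⟩
  simpa using measure_mono (μ := volume) h'

theorem hausdorffMeasure_image_le_ofReal {h : ℝ → Y} {D : Set ℝ} {L a b : ℝ}
    (hL : ∀ t ∈ D, ∀ s ∈ D, dist (h t) (h s) ≤ L * |t - s|) (hD : D ⊆ Set.Icc a b) :
    μH[1] (h '' D) ≤ ENNReal.ofReal (L * (b - a)) := by
  rcases D.eq_empty_or_nonempty with rfl | ⟨t₀, ht₀⟩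
  · simp
  have hab : a ≤ b := (hD ht₀).1.trans (hD ht₀).2
  have hlip : LipschitzOnWith L.toNNReal h D := by
    refine LipschitzOnWith.of_dist_le_mul fun t ht s hs => (hL t ht s hs).trans ?_
    rw [Real.dist_eq]
    exact mul_le_mul_of_nonneg_right (Real.le_coe_toNNReal L) (abs_nonneg _)
  have h1 := hlip.hausdorffMeasure_image_le (d := 1) zero_le_one
  rw [hausdorffMeasure_real, ENNReal.rpow_one] at h1
  refine h1.trans ?_
  have h2 : volume D ≤ ENNReal.ofReal (b - a) := by simpa using measure_mono (μ := volume) hD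
  rw [ENNReal.ofReal_mul' (by linarith)]
  exact mul_le_mul' le_rfl h2

/-- A bi-Lipschitz arc meets every ball in a set of length comparable to the radius at most. -/
theorem hausdorffMeasure_image_inter_ball_le {h : ℝ → Y} {D : Set ℝ} {L k : ℝ} (hk : 0 < k)
    (hL : ∀ t ∈ D, ∀ s ∈ D, dist (h t) (h s) ≤ L * |t - s|)
    (hl : ∀ t ∈ D, ∀ s ∈ D, k * |t - s| ≤ dist (h t) (h s)) (x : Y) (r : ℝ) :
    μH[1] (h '' D ∩ Metric.ball x r) ≤ ENNReal.ofReal (L * (4 * r / k)) := by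
  have himg : h '' D ∩ Metric.ball x r = h '' {t | t ∈ D ∧ h t ∈ Metric.ball x r} := by
    ext y
    constructor
    · rintro ⟨⟨t, ht, rfl⟩, hy⟩
      exact ⟨t, ⟨ht, hy⟩, rfl⟩
    · rintro ⟨t, ⟨ht, hy⟩, rfl⟩
      exact ⟨⟨t, ht, rfl⟩, hy⟩
  rw [himg]
  rcases Set.eq_empty_or_nonempty {t | t ∈ D ∧ h t ∈ Metric.ball x r} with he | ⟨t₀, ht₀, hb₀⟩
  · rw [he]
    simp
  -- Two parameters sent into the ball have images less than 2r apart, hence differ by at most 2r/k.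
  have hsub : {t | t ∈ D ∧ h t ∈ Metric.ball x r} ⊆
      Set.Icc (t₀ - 2 * r / k) (t₀ + 2 * r / k) := by
    rintro t ⟨ht, hb⟩
    have h1 := hl t ht t₀ ht₀
    have h2 := dist_triangle_right (h t) (h t₀) x
    rw [Metric.mem_ball] at hb hb₀
    have h3 : |t - t₀| ≤ 2 * r / k := by
      rw [le_div_iff₀ hk]
      linarith
    rw [abs_le] at h3
    constructor <;> linarith [h3.1, h3.2]
  have := hausdorffMeasure_image_le_ofReal
    (fun t ht s hs => hL t ht.1 s hs.1) hsub
  convert this using 3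
  ring

end HausdorffLength

/-! ### The perturbation and the perturbed arc -/

theorem abs_eps₁_le (t : ℝ) : |eps₁ t| ≤ Real.exp (-(1 / t ^ 2)) := by
  rw [eps₁, abs_mul, abs_of_pos (Real.exp_pos _)]
  exact mul_le_of_le_one_right (Real.exp_pos _).le (Real.abs_sin_le_one _)

theorem abs_eps₁_le_sq {t : ℝ} (ht : 0 < t) : |eps₁ t| ≤ t ^ 2 := by
  refine (abs_eps₁_le t).trans ?_
  rw [Real.exp_neg]
  refine inv_le_of_inv_le₀ (by positivity) ?_
  rw [← one_div]
  linarith [Real.add_one_le_exp (1 / t ^ 2)]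

/-- The radius 1 + `eps₁ t` thus stays in [δ, 2 - δ]: the arc avoids the origin and remains inside
the doubled ball. -/
theorem exists_abs_eps₁_le : ∃ δ : ℝ, 0 < δ ∧
    ∀ t ∈ Set.Ioo 0 Real.pi, |eps₁ t| ≤ 1 - δ := by
  refine ⟨1 - Real.exp (-(1 / Real.pi ^ 2)), ?_, ?_⟩
  · have : Real.exp (-(1 / Real.pi ^ 2)) < 1 := by
      rw [Real.exp_lt_one_iff]
      have := Real.pi_pos
      simp only [Left.neg_neg_iff]
      positivity
    linarith
  · rintro t ⟨h0, hpi⟩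
    refine (abs_eps₁_le t).trans ?_
    have : 1 / Real.pi ^ 2 ≤ 1 / t ^ 2 := by gcongr
    have : Real.exp (-(1 / t ^ 2)) ≤ Real.exp (-(1 / Real.pi ^ 2)) := by gcongr
    linarith

theorem hasDerivAt_eps₁ {t : ℝ} (ht : t ≠ 0) :
    HasDerivAt eps₁ (Real.exp (-(1 / t ^ 2)) * (2 / t ^ 3) *
        Real.sin (Real.pi * Real.exp (1 / t - 1 / Real.pi)) +
      Real.exp (-(1 / t ^ 2)) * (Real.cos (Real.pi * Real.exp (1 / t - 1 / Real.pi)) *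
        (Real.pi * (Real.exp (1 / t - 1 / Real.pi) * (-(1 / t ^ 2)))))) t := by
  have h1 : HasDerivAt (fun t : ℝ => -(1 / t ^ 2)) (2 / t ^ 3) t := by
    have := ((hasDerivAt_pow 2 t).inv (pow_ne_zero 2 ht)).neg
    refine (this.congr_of_eventuallyEq (.of_eq ?_)).congr_deriv ?_
    · funext s; simp
    · field_simp
      norm_num [mul_comm]
  have h2 : HasDerivAt (fun t : ℝ => 1 / t - 1 / Real.pi) (-(1 / t ^ 2)) t := by
    have := (hasDerivAt_inv ht).sub_const (1 / Real.pi)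
    refine (this.congr_of_eventuallyEq (.of_eq ?_)).congr_deriv ?_
    · funext s; simp
    · simp
  exact h1.exp.mul ((h2.exp.const_mul Real.pi).sin)

/-- With s = 1/t, this bound and the next control the two terms of the derivative of `eps₁`. -/
theorem exp_neg_sq_mul_cube_le (s : ℝ) : Real.exp (-s ^ 2) * (2 * s ^ 3) ≤ 3 := by
  rw [Real.exp_neg, inv_mul_le_iff₀ (Real.exp_pos _)]
  have h1 := Real.quadratic_le_exp_of_nonneg (sq_nonneg s)
  nlinarith [sq_nonneg (s ^ 2 - s), sq_nonneg s]

/-- One half of the Gaussian absorbs s², the other absorbs exp(s), because s ≤ (1 + s²)/2. -/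
theorem exp_neg_sq_mul_sq_mul_exp_le (s : ℝ) :
    Real.exp (-s ^ 2) * (s ^ 2 * Real.exp s) ≤ 4 := by
  have h1 : s ^ 2 ≤ 2 * Real.exp (s ^ 2 / 2) := by
    linarith [Real.add_one_le_exp (s ^ 2 / 2)]
  have h2 : Real.exp s ≤ Real.exp (1 / 2) * Real.exp (s ^ 2 / 2) := by
    rw [← Real.exp_add]
    gcongr
    nlinarith [sq_nonneg (s - 1)]
  have h3 : Real.exp (1 / 2) ≤ 2 := by
    have h := Real.exp_one_lt_d9
    have h4 : Real.exp (1 / 2) * Real.exp (1 / 2) = Real.exp 1 := by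
      rw [← Real.exp_add]; norm_num
    nlinarith [Real.exp_pos (1 / 2)]
  rw [Real.exp_neg, inv_mul_le_iff₀ (Real.exp_pos _)]
  have h5 : Real.exp (s ^ 2 / 2) * Real.exp (s ^ 2 / 2) = Real.exp (s ^ 2) := by
    rw [← Real.exp_add]; ring_nf
  calc s ^ 2 * Real.exp s
      ≤ (2 * Real.exp (s ^ 2 / 2)) * (2 * Real.exp (s ^ 2 / 2)) := by
        refine mul_le_mul h1 (h2.trans ?_) (Real.exp_pos _).le (by positivity)
        gcongr
    _ = Real.exp (s ^ 2) * 4 := by rw [← h5]; ring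

theorem abs_eps₁_sub_le {t s : ℝ} (ht : t ∈ Set.Ioo 0 Real.pi) (hs : s ∈ Set.Ioo 0 Real.pi) :
    |eps₁ t - eps₁ s| ≤ 16 * |t - s| := by
  -- The derivative is bounded by 3 + 4π < 16.
  refine (convex_Ioo 0 Real.pi).norm_image_sub_le_of_norm_hasDerivWithin_le
    (fun x hx => (hasDerivAt_eps₁ hx.1.ne').hasDerivWithinAt) ?_ hs ht
  rintro x ⟨hx, -⟩
  have hpi := Real.pi_pos
  have hpi' := Real.pi_lt_d2
  have hx' : (0 : ℝ) < 1 / x := by positivity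
  have b1 := exp_neg_sq_mul_cube_le (1 / x)
  have b2 := exp_neg_sq_mul_sq_mul_exp_le (1 / x)
  have e1 : (1 / x) ^ 2 = 1 / x ^ 2 := by rw [div_pow, one_pow]
  have e2 : 2 * (1 / x) ^ 3 = 2 / x ^ 3 := by field_simp
  rw [e1, e2] at b1
  rw [e1] at b2
  have b3 : Real.exp (1 / x - 1 / Real.pi) ≤ Real.exp (1 / x) := by
    gcongr
    have : 0 < 1 / Real.pi := by positivity
    linarith
  have b4 : Real.exp (-(1 / x ^ 2)) * (Real.pi * (Real.exp (1 / x - 1 / Real.pi) * (1 / x ^ 2))) ≤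
      Real.pi * 4 := by
    calc _ ≤ Real.exp (-(1 / x ^ 2)) * (Real.pi * (Real.exp (1 / x) * (1 / x ^ 2))) := by gcongr
      _ = Real.pi * (Real.exp (-(1 / x ^ 2)) * (1 / x ^ 2 * Real.exp (1 / x))) := by ring
      _ ≤ Real.pi * 4 := by gcongr
  refine (norm_add_le _ _).trans ?_
  simp only [norm_mul, Real.norm_eq_abs, abs_neg, Real.abs_exp]
  rw [abs_of_pos hpi, abs_of_pos (show 0 < 2 / x ^ 3 by positivity),
    abs_of_pos (show 0 < 1 / x ^ 2 by positivity)]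
  have b5 := mul_le_of_le_one_right (a := Real.exp (-(1 / x ^ 2)) * (2 / x ^ 3)) (by positivity)
    (Real.abs_sin_le_one (Real.pi * Real.exp (1 / x - 1 / Real.pi)))
  have b6 : Real.exp (-(1 / x ^ 2)) * (|Real.cos (Real.pi * Real.exp (1 / x - 1 / Real.pi))| *
        (Real.pi * (Real.exp (1 / x - 1 / Real.pi) * (1 / x ^ 2)))) ≤
      Real.exp (-(1 / x ^ 2)) * (Real.pi * (Real.exp (1 / x - 1 / Real.pi) * (1 / x ^ 2))) :=
    mul_le_mul_of_nonneg_left (mul_le_of_le_one_left (by positivity) (Real.abs_cos_le_one _))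
      (Real.exp_pos _).le
  linarith

theorem curve_of_mem_Ioo (ε : ℝ → ℝ) {t : ℝ} (ht : t ∈ Set.Ioo 0 Real.pi) :
    curve ε t = ⟨(1 + ε t) * Real.cos t, (1 + ε t) * Real.sin t⟩ := by
  rw [curve, if_neg (not_le.2 ht.1), if_pos ht.2]

/-- Law of cosines, with the radial difference separated from the angular part. -/
theorem dist_curve_sq (ε : ℝ → ℝ) {t s : ℝ} (ht : t ∈ Set.Ioo 0 Real.pi)
    (hs : s ∈ Set.Ioo 0 Real.pi) :
    dist (curve ε t) (curve ε s) ^ 2 =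
      (ε t - ε s) ^ 2 + 2 * ((1 + ε t) * (1 + ε s)) * (1 - Real.cos (t - s)) := by
  rw [Complex.dist_eq, Complex.sq_norm, Complex.normSq_apply, curve_of_mem_Ioo ε ht,
    curve_of_mem_Ioo ε hs, Complex.sub_re, Complex.sub_im, Real.cos_sub]
  linear_combination (1 + ε t) ^ 2 * Real.sin_sq_add_cos_sq t +
    (1 + ε s) ^ 2 * Real.sin_sq_add_cos_sq s

theorem dist_curve_eps₁_le {t s : ℝ} (ht : t ∈ Set.Ioo 0 Real.pi) (hs : s ∈ Set.Ioo 0 Real.pi) :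
    dist (curve eps₁ t) (curve eps₁ s) ≤ 17 * |t - s| := by
  obtain ⟨δ, hδ, hb⟩ := exists_abs_eps₁_le
  refine le_of_sq_le_sq ?_ (by positivity)
  rw [dist_curve_sq _ ht hs, mul_pow, sq_abs]
  have h1 := sq_le_sq' (by linarith [neg_abs_le (eps₁ t - eps₁ s), abs_eps₁_sub_le ht hs])
    ((le_abs_self _).trans (abs_eps₁_sub_le ht hs))
  rw [mul_pow, sq_abs] at h1
  have h2 := Real.one_sub_sq_div_two_le_cos (x := t - s)
  have h3 := abs_le.1 (hb t ht)
  have h4 := abs_le.1 (hb s hs)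
  have h5 : (1 + eps₁ t) * (1 + eps₁ s) ≤ 2 * 2 :=
    mul_le_mul (by linarith) (by linarith) (by linarith) (by norm_num)
  have h6 : (1 + eps₁ t) * (1 + eps₁ s) * (1 - Real.cos (t - s)) ≤ 2 * 2 * ((t - s) ^ 2 / 2) :=
    mul_le_mul h5 (by linarith) (by linarith [Real.cos_le_one (t - s)]) (by norm_num)
  nlinarith [sq_nonneg (t - s)]

/-- The angular part suffices: both radii are at least δ, and 1 - cos x ≥ 2x²/π² for |x| ≤ π. -/
theorem exists_mul_abs_sub_le_dist_curve_eps₁ : ∃ k : ℝ, 0 < k ∧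
    ∀ t ∈ Set.Ioo 0 Real.pi, ∀ s ∈ Set.Ioo 0 Real.pi,
      k * |t - s| ≤ dist (curve eps₁ t) (curve eps₁ s) := by
  obtain ⟨δ, hδ, hb⟩ := exists_abs_eps₁_le
  have hpi := Real.pi_pos
  refine ⟨2 * δ / Real.pi, by positivity, fun t ht s hs => le_of_sq_le_sq ?_ dist_nonneg⟩
  rw [dist_curve_sq _ ht hs, mul_pow, sq_abs]
  have h1 : |t - s| ≤ Real.pi := by
    rw [abs_le]; constructor <;> linarith [ht.1, ht.2, hs.1, hs.2]
  have h2 := Real.cos_le_one_sub_mul_cos_sq h1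
  have h3 := abs_le.1 (hb t ht)
  have h4 := abs_le.1 (hb s hs)
  have h5 : δ * δ ≤ (1 + eps₁ t) * (1 + eps₁ s) :=
    mul_le_mul (by linarith) (by linarith) hδ.le (by linarith)
  have h6 : δ * δ * (2 / Real.pi ^ 2 * (t - s) ^ 2) ≤
      (1 + eps₁ t) * (1 + eps₁ s) * (1 - Real.cos (t - s)) :=
    mul_le_mul h5 (by linarith) (by positivity) (by nlinarith)
  have h7 : (2 * δ / Real.pi) ^ 2 * (t - s) ^ 2 =
      2 * (δ * δ * (2 / Real.pi ^ 2 * (t - s) ^ 2)) := by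
    field_simp
  rw [h7]
  nlinarith [sq_nonneg (eps₁ t - eps₁ s)]

/-! ### The space `X₁` is of homogeneous type -/

/-- The point of `X₁` with parameter `t`, for `t ≥ -1`. -/
noncomputable def point₁ (t : ℝ) : X₁ :=
  ⟨curve eps₁ (max (-1) t), Set.mem_image_of_mem _ (Set.mem_Ici.2 (le_max_left _ _))⟩

theorem coe_point₁ {t : ℝ} (ht : -1 ≤ t) : (point₁ t : ℂ) = curve eps₁ t := by
  simp only [point₁, max_eq_right ht]

theorem dist_point₁_le {t s : ℝ} (ht : t ∈ Set.Ioo 0 Real.pi) (hs : s ∈ Set.Ioo 0 Real.pi) :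
    dist (point₁ t) (point₁ s) ≤ 17 * |t - s| := by
  rw [Subtype.dist_eq, coe_point₁ (by linarith [ht.1]), coe_point₁ (by linarith [hs.1])]
  exact dist_curve_eps₁_le ht hs

theorem exists_mul_abs_sub_le_dist_point₁ : ∃ k : ℝ, 0 < k ∧
    ∀ t ∈ Set.Ioo 0 Real.pi, ∀ s ∈ Set.Ioo 0 Real.pi,
      k * |t - s| ≤ dist (point₁ t) (point₁ s) := by
  obtain ⟨k, hk, h⟩ := exists_mul_abs_sub_le_dist_curve_eps₁
  refine ⟨k, hk, fun t ht s hs => ?_⟩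
  rw [Subtype.dist_eq, coe_point₁ (by linarith [ht.1]), coe_point₁ (by linarith [hs.1])]
  exact h t ht s hs

theorem continuousOn_point₁ : ContinuousOn point₁ (Set.Ioo 0 Real.pi) := by
  have h : LipschitzOnWith 17 point₁ (Set.Ioo 0 Real.pi) :=
    LipschitzOnWith.of_dist_le_mul fun t ht s hs => dist_point₁_le ht hs
  exact h.continuousOn

/-- Membership of an arc point in the unit ball is therefore decided by the sign of `eps₁ t`. -/
theorem dist_point₁_origin₁ {t : ℝ} (ht : t ∈ Set.Ioo 0 Real.pi) :
    dist (point₁ t) origin₁ = 1 + eps₁ t := by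
  obtain ⟨δ, hδ, hb⟩ := exists_abs_eps₁_le
  have h1 := abs_le.1 (hb t ht)
  rw [Subtype.dist_eq, coe_point₁ (by linarith [ht.1]), origin₁, dist_zero_right]
  refine (pow_left_inj₀ (norm_nonneg _) (by linarith) two_ne_zero).1 ?_
  rw [Complex.sq_norm, Complex.normSq_apply, curve_of_mem_Ioo _ ht]
  linear_combination (1 + eps₁ t) ^ 2 * Real.sin_sq_add_cos_sq t

/-! ### Connectedness of the curve and linear growth of length -/

theorem curveSpace_eq_union (ε : ℝ → ℝ) : curveSpace ε =
    (fun x : ℝ => (x : ℂ)) '' Set.Iic 1 ∪ curve ε '' Set.Ioo 0 Real.pi := by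
  ext z
  constructor
  · rintro ⟨t, ht, rfl⟩
    -- The initial segment covers [0, 1] and the final piece ]-∞, 0]; together they form one
    -- half-line.
    rcases le_or_gt t 0 with h0 | h0
    · refine Or.inl ⟨t + 1, by simpa using h0, ?_⟩
      rw [curve, if_pos h0]
      rfl
    rcases lt_or_ge t Real.pi with hpi | hpi
    · exact Or.inr ⟨t, ⟨h0, hpi⟩, rfl⟩
    · refine Or.inl ⟨Real.pi - t, by simp; linarith, ?_⟩
      rw [curve, if_neg (not_le.2 h0), if_neg (not_lt.2 hpi)]
      rfl
  · rintro (⟨x, hx, rfl⟩ | ⟨t, ht, rfl⟩)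
    · rcases le_or_gt 0 x with h0 | h0
      · refine ⟨x - 1, by simpa using h0, ?_⟩
        rw [curve, if_pos (by simpa using hx)]
        apply Complex.ext <;> simp
      · have := Real.pi_pos
        refine ⟨Real.pi - x, by simp; linarith, ?_⟩
        rw [curve, if_neg (by linarith), if_neg (by linarith)]
        apply Complex.ext <;> simp
    · exact ⟨t, by simp; linarith [ht.1], rfl⟩

theorem dist_curve_eps₁_one_le {t : ℝ} (ht : t ∈ Set.Ioo 0 Real.pi) :
    dist (curve eps₁ t) 1 ≤ t ^ 2 + 2 * t := by
  have h0 := ht.1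
  refine le_of_sq_le_sq ?_ (by positivity)
  obtain ⟨δ, hδ, hb⟩ := exists_abs_eps₁_le
  have h1 := abs_le.1 (hb t ht)
  have h2 := abs_eps₁_le_sq h0
  have h3 : eps₁ t ^ 2 ≤ (t ^ 2) ^ 2 := sq_le_sq' (abs_le.1 h2).1 (abs_le.1 h2).2
  have h4 := Real.one_sub_sq_div_two_le_cos (x := t)
  have h5 : dist (curve eps₁ t) 1 ^ 2 = eps₁ t ^ 2 + 2 * ((1 + eps₁ t) * (1 - Real.cos t)) := by
    rw [Complex.dist_eq, Complex.sq_norm, Complex.normSq_apply, curve_of_mem_Ioo _ ht,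
      Complex.sub_re, Complex.sub_im, Complex.one_re, Complex.one_im]
    linear_combination (1 + eps₁ t) ^ 2 * Real.sin_sq_add_cos_sq t
  have h6 : (1 + eps₁ t) * (1 - Real.cos t) ≤ 2 * (t ^ 2 / 2) :=
    mul_le_mul (by linarith) (by linarith) (by linarith [Real.cos_le_one t]) (by norm_num)
  rw [h5]
  nlinarith [pow_pos h0 3, pow_pos h0 2]

/-- The arc, taken over an open parameter interval, accumulates at 1 as t → 0, and 1 belongs to the
half-line. -/
instance : PreconnectedSpace X₁ := by
  refine Subtype.preconnectedSpace ?_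
  have hcont : ContinuousOn (curve eps₁) (Set.Ioo 0 Real.pi) := by
    have h : LipschitzOnWith 17 (curve eps₁) (Set.Ioo 0 Real.pi) :=
      LipschitzOnWith.of_dist_le_mul fun t ht s hs => dist_curve_eps₁_le ht hs
    exact h.continuousOn
  have h1 : (1 : ℂ) ∈ closure (curve eps₁ '' Set.Ioo 0 Real.pi) := by
    refine Metric.mem_closure_iff.2 fun ε hε => ?_
    have hpi := Real.pi_gt_three
    have hm : 0 < min (ε / 4) 1 := by positivity
    have hmem : min (ε / 4) 1 ∈ Set.Ioo 0 Real.pi :=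
      ⟨hm, (min_le_right _ _).trans_lt (by linarith)⟩
    refine ⟨_, ⟨_, hmem, rfl⟩, ?_⟩
    rw [dist_comm]
    refine (dist_curve_eps₁_one_le hmem).trans_lt ?_
    have := min_le_right (ε / 4) 1
    have := min_le_left (ε / 4) 1
    nlinarith
  have hA : IsPreconnected (insert (1 : ℂ) (curve eps₁ '' Set.Ioo 0 Real.pi)) :=
    (isPreconnected_Ioo.image _ hcont).subset_closure (Set.subset_insert _ _)
      (Set.insert_subset h1 subset_closure)
  have hR : IsPreconnected ((fun x : ℝ => (x : ℂ)) '' Set.Iic 1) :=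
    isPreconnected_Iic.image _ (by fun_prop)
  have hone : (1 : ℂ) ∈ (fun x : ℝ => (x : ℂ)) '' Set.Iic 1 := ⟨1, by simp, by simp⟩
  have := hR.union 1 hone (Set.mem_insert _ _) hA
  rwa [Set.union_insert, Set.insert_eq_of_mem (Set.mem_union_left _ hone), ← curveSpace_eq_union] at this

theorem exists_le_dist (x : X₁) (r : ℝ) : ∃ y : X₁, r ≤ dist x y := by
  have hmem : ((-(|r| + ‖(x : ℂ)‖) : ℝ) : ℂ) ∈ curveSpace eps₁ :=
    (curveSpace_eq_union eps₁).ge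
      (Or.inl ⟨_, by simp; linarith [abs_nonneg r, norm_nonneg (x : ℂ)], rfl⟩)
  refine ⟨⟨_, hmem⟩, ?_⟩
  rw [Subtype.dist_eq, dist_comm, Complex.dist_eq]
  have h := norm_sub_norm_le ((-(|r| + ‖(x : ℂ)‖) : ℝ) : ℂ) (x : ℂ)
  rw [Complex.norm_real, Real.norm_eq_abs, abs_neg,
    abs_of_nonneg (add_nonneg (abs_nonneg r) (norm_nonneg _))] at h
  linarith [le_abs_self r]

theorem ofReal_le_length₁_ball (x : X₁) (r : ℝ) :
    ENNReal.ofReal r ≤ length₁ (Metric.ball x r) :=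
  ofReal_le_hausdorffMeasure_ball x (exists_le_dist x) r

theorem exists_length₁_ball_le : ∃ K : ℝ, 0 < K ∧ ∀ (x : X₁) (r : ℝ), 0 < r →
    length₁ (Metric.ball x r) ≤ ENNReal.ofReal (K * r) := by
  obtain ⟨k, hk, hl⟩ := exists_mul_abs_sub_le_dist_curve_eps₁
  -- The 4 comes from the real line (both Lipschitz constants 1), the rest from the arc.
  refine ⟨4 + 17 * (4 / k), by positivity, fun x r hr => ?_⟩
  rw [length₁, ← isometry_subtype_coe.hausdorffMeasure_image (Or.inl zero_le_one)]
  have hsub : (Subtype.val : X₁ → ℂ) '' Metric.ball x r ⊆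
      ((fun s : ℝ => (s : ℂ)) '' Set.univ ∩ Metric.ball (x : ℂ) r) ∪
        (curve eps₁ '' Set.Ioo 0 Real.pi ∩ Metric.ball (x : ℂ) r) := by
    rintro _ ⟨y, hy, rfl⟩
    rw [← Set.union_inter_distrib_right]
    refine ⟨?_, hy⟩
    exact ((curveSpace_eq_union eps₁).le y.2).imp (fun h => Set.image_mono (Set.subset_univ _) h) id
  refine (measure_mono hsub).trans ((measure_union_le _ _).trans ?_)
  have h1 := hausdorffMeasure_image_inter_ball_le (h := fun s : ℝ => (s : ℂ)) (D := Set.univ)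
    (L := 1) (k := 1) one_pos (fun t _ s _ => by simp [Complex.dist_eq, ← Complex.ofReal_sub])
    (fun t _ s _ => by simp [Complex.dist_eq, ← Complex.ofReal_sub]) (x : ℂ) r
  have h2 := hausdorffMeasure_image_inter_ball_le hk
    (fun t ht s hs => dist_curve_eps₁_le ht hs) hl (x : ℂ) r
  refine (add_le_add h1 h2).trans ?_
  rw [← ENNReal.ofReal_add (by positivity) (by positivity)]
  apply ENNReal.ofReal_le_ofReal
  apply le_of_eq
  ring

/-- Since r ≤ Λ(B(x,r)) ≤ K r, doubling holds with constant 2K. -/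
theorem isHomogeneousType_length₁ : IsHomogeneousType length₁ := by
  obtain ⟨K, hK, hball⟩ := exists_length₁_ball_le
  have hpos : ∀ (x : X₁) (r : ℝ), 0 < r → 0 < length₁ (Metric.ball x r) := fun x r hr =>
    (ENNReal.ofReal_pos.2 hr).trans_le (ofReal_le_length₁_ball x r)
  refine ⟨(hpos origin₁ 1 one_pos).trans_le (measure_mono (Set.subset_univ _)),
    (2 * K).toNNReal, fun x r hr => ⟨hpos x _ (by positivity), ?_, ?_⟩⟩
  · refine (hball x (2 * r) (by positivity)).trans ?_
    rw [show K * (2 * r) = 2 * K * r by ring, ENNReal.ofReal_mul (by positivity)]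
    exact mul_le_mul' le_rfl (ofReal_le_length₁_ball x r)
  · exact ENNReal.mul_lt_top ENNReal.coe_lt_top
      ((hball x r hr).trans_lt ENNReal.ofReal_lt_top)

/-! ### The layers of the unit ball -/

/-- The parameter at which `exp (1 / t - 1 / π)` takes the value `u`. -/
noncomputable def param (u : ℝ) : ℝ := (1 / Real.pi + Real.log u)⁻¹

theorem denominator_pos {u : ℝ} (hu : 1 ≤ u) : 0 < 1 / Real.pi + Real.log u := by
  have := Real.log_nonneg hu
  have := Real.pi_pos
  positivity

theorem param_mem_Ioo {u : ℝ} (hu : 1 < u) : param u ∈ Set.Ioo 0 Real.pi := by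
  refine ⟨inv_pos.2 (denominator_pos hu.le), ?_⟩
  have h1 := Real.log_pos hu
  have h2 := Real.pi_pos
  refine inv_lt_of_inv_lt₀ h2 ?_
  rw [← one_div]
  linarith

theorem eps₁_param {u : ℝ} (hu : 0 < u) :
    eps₁ (param u) = Real.exp (-(1 / param u ^ 2)) * Real.sin (Real.pi * u) := by
  have h : 1 / param u - 1 / Real.pi = Real.log u := by
    rw [param, one_div, inv_inv]
    ring
  rw [eps₁, h, Real.exp_log hu]

theorem param_exp {t : ℝ} : param (Real.exp (1 / t - 1 / Real.pi)) = t := by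
  rw [param, Real.log_exp]
  simp

theorem point₁_param_mem_ball {u : ℝ} (hu : 1 < u) (hs : Real.sin (Real.pi * u) < 0) :
    point₁ (param u) ∈ Metric.ball origin₁ 1 := by
  rw [Metric.mem_ball, dist_point₁_origin₁ (param_mem_Ioo hu), eps₁_param (by linarith)]
  linarith [mul_neg_of_pos_of_neg (Real.exp_pos (-(1 / param u ^ 2))) hs]

theorem point₁_param_notMem_ball {u : ℝ} (hu : 1 < u) (hs : 0 ≤ Real.sin (Real.pi * u)) :
    point₁ (param u) ∉ Metric.ball origin₁ 1 := by
  rw [Metric.mem_ball, dist_point₁_origin₁ (param_mem_Ioo hu), eps₁_param (by linarith)]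
  linarith [mul_nonneg (Real.exp_pos (-(1 / param u ^ 2))).le hs]

theorem param_sub_param {u w : ℝ} (hu : 1 ≤ u) (hw : 1 ≤ w) :
    param u - param w =
      Real.log (w / u) / ((1 / Real.pi + Real.log u) * (1 / Real.pi + Real.log w)) := by
  rw [param, param, inv_sub_inv (denominator_pos hu).ne' (denominator_pos hw).ne',
    Real.log_div (by linarith) (by linarith)]
  ring

theorem param_lt_param {u w : ℝ} (hu : 1 ≤ u) (h : u < w) : param w < param u := by
  rw [← sub_pos, param_sub_param hu (hu.trans h.le)]
  exact div_pos (Real.log_pos ((one_lt_div (by linarith)).2 h))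
    (mul_pos (denominator_pos hu) (denominator_pos (hu.trans h.le)))

/-- The closed interval is allowed because points on the circle lie outside the open ball. -/
theorem sin_pi_mul_nonneg (j : ℕ) {u : ℝ} (h1 : 2 * (j : ℝ) ≤ u) (h2 : u ≤ 2 * j + 1) :
    0 ≤ Real.sin (Real.pi * u) := by
  have hpi := Real.pi_pos
  rw [← Real.sin_sub_nat_mul_two_pi _ j]
  exact Real.sin_nonneg_of_nonneg_of_le_pi (by nlinarith) (by nlinarith)

theorem sin_pi_mul_neg (j : ℕ) {u : ℝ} (h1 : 2 * (j : ℝ) + 1 < u) (h2 : u < 2 * j + 2) :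
    Real.sin (Real.pi * u) < 0 := by
  have hpi := Real.pi_pos
  rw [← neg_pos, ← Real.sin_neg, ← Real.sin_add_nat_mul_two_pi _ (j + 1)]
  push_cast
  exact Real.sin_pos_of_pos_of_lt_pi (by nlinarith) (by nlinarith)

/-- Going back in parameter by `O(exp (-1/t))`, the curve reaches both sides of the unit circle. -/
theorem exists_point₁_near {t : ℝ} (ht : t ∈ Set.Ioo 0 Real.pi) :
    ∃ y z : X₁, y ∈ Metric.ball origin₁ 1 ∧ z ∉ Metric.ball origin₁ 1 ∧
      dist (point₁ t) y ≤ 2000 * Real.exp (-(1 / t)) ∧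
      dist (point₁ t) z ≤ 2000 * Real.exp (-(1 / t)) := by
  have hpi := Real.pi_pos
  set u := Real.exp (1 / t - 1 / Real.pi) with hu
  have hu1 : 1 < u := by
    rw [hu, Real.one_lt_exp_iff, sub_pos]
    exact one_div_lt_one_div_of_lt ht.1 ht.2
  have hut : param u = t := param_exp
  -- A window of length 4 in u leaves room for an outer and an inner point. Discarding the
  -- logarithms in the denominator costs only a factor t², and 17 · 4 · 3.15² · 2.72 < 2000.
  have key : ∀ w, u ≤ w → w ≤ u + 4 →
      dist (point₁ t) (point₁ (param w)) ≤ 2000 * Real.exp (-(1 / t)) := by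
    intro w h1 h2
    have h3 : (1 / Real.pi) * (1 / Real.pi) ≤
        (1 / Real.pi + Real.log u) * (1 / Real.pi + Real.log w) := by
      have := Real.log_nonneg hu1.le
      have := Real.log_nonneg (hu1.le.trans h1)
      gcongr <;> linarith
    have h4 : 0 ≤ Real.log (w / u) := Real.log_nonneg ((one_le_div (by linarith)).2 h1)
    have h5 : Real.log (w / u) ≤ 4 / u := by
      refine (Real.log_le_sub_one_of_pos (div_pos (by linarith) (by linarith))).trans ?_
      rw [div_sub_one (by linarith)]
      gcongr
      linarith
    have h6 : param u - param w ≤ (4 / u) / ((1 / Real.pi) * (1 / Real.pi)) := by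
      rw [param_sub_param hu1.le (hu1.le.trans h1)]
      gcongr
    have h7 : 0 ≤ param u - param w := by
      rw [param_sub_param hu1.le (hu1.le.trans h1)]
      exact div_nonneg h4 (le_trans (by positivity) h3)
    have h8 : u⁻¹ = Real.exp (1 / Real.pi) * Real.exp (-(1 / t)) := by
      rw [hu, ← Real.exp_neg, ← Real.exp_add]
      ring_nf
    have h9 : Real.exp (1 / Real.pi) ≤ 2.7182818286 := by
      refine le_trans ?_ Real.exp_one_lt_d9.le
      gcongr
      rw [div_le_one hpi]
      linarith [Real.pi_gt_three]
    refine (dist_point₁_le ht (param_mem_Ioo (hu1.trans_le h1))).trans ?_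
    rw [← hut, abs_of_nonneg h7, hut]
    have h10 : (4 / u) / ((1 / Real.pi) * (1 / Real.pi)) =
        4 * Real.pi ^ 2 * Real.exp (1 / Real.pi) * Real.exp (-(1 / t)) := by
      rw [div_eq_mul_inv 4 u, h8]
      field_simp
    rw [h10, hut] at h6
    have h11 : 4 * Real.pi ^ 2 * Real.exp (1 / Real.pi) ≤ 4 * 3.15 ^ 2 * 2.7182818286 := by
      gcongr
      exact Real.pi_lt_d2.le
    have h12 := Real.exp_pos (-(1 / t))
    nlinarith
  -- 2j is the first even integer not below u, so 2j < u + 2. The value 2j lies on the circle, and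
  -- 2j + 3/2 in the middle of an inner piece.
  set j := ⌈u / 2⌉₊ with hj
  have hj1 : u / 2 ≤ j := Nat.le_ceil _
  have hj2 : (j : ℝ) < u / 2 + 1 := Nat.ceil_lt_add_one (by linarith)
  refine ⟨point₁ (param (2 * j + 3 / 2)), point₁ (param (2 * j)),
    point₁_param_mem_ball (by linarith)
      (sin_pi_mul_neg j (by linarith) (by linarith)),
    point₁_param_notMem_ball (by linarith) (sin_pi_mul_nonneg j le_rfl (by linarith)),
    key _ (by linarith) (by linarith), key _ (by linarith) (by linarith)⟩

theorem point₁_mem_layer {t ε : ℝ} (ht : t ∈ Set.Ioo 0 Real.pi)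
    (hε : 2000 * Real.exp (-(1 / t)) ≤ ε) : point₁ t ∈ layer origin₁ 1 ε := by
  obtain ⟨y, z, hy, hz, hty, htz⟩ := exists_point₁_near ht
  have aux : ∀ {S : Set X₁} {w : X₁}, w ∈ S → dist (point₁ t) w ≤ 2000 * Real.exp (-(1 / t)) →
      Metric.infEDist (point₁ t) S ≤ ENNReal.ofReal ε := fun hw hd =>
    (Metric.infEDist_le_edist_of_mem hw).trans
      (by rw [edist_dist]; exact ENNReal.ofReal_le_ofReal (hd.trans hε))
  by_cases h : point₁ t ∈ Metric.ball origin₁ 1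
  · exact Or.inl ⟨h, aux (Set.mem_compl hz) htz⟩
  · exact Or.inr ⟨h, aux hy hty⟩

theorem exists_le_length₁_layer : ∃ c : ℝ, 0 < c ∧ ∀ ε : ℝ, 0 < ε → ε ≤ 1 / 2 →
    ENNReal.ofReal (c / |Real.log ε|) ≤ length₁ (layer origin₁ 1 ε) := by
  obtain ⟨k, hk, hl⟩ := exists_mul_abs_sub_le_dist_point₁
  have hK : 0 < Real.log 2000 := Real.log_pos (by norm_num)
  have h2 : 0 < Real.log 2 := Real.log_pos (by norm_num)
  -- As -ln ε ≥ ln 2, the additive term ln 2000 is absorbed into a multiple of -ln ε.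
  set A := 1 + Real.log 2000 / Real.log 2 with hA
  have hA0 : 0 < A := by positivity
  refine ⟨k / (2 * A), by positivity, fun ε hε hε2 => ?_⟩
  have hlog : Real.log 2 ≤ -Real.log ε := by
    rw [← Real.log_inv]
    refine Real.log_le_log (by norm_num) ?_
    rw [le_inv_comm₀ (by norm_num) hε]
    linarith
  rw [abs_of_neg (by linarith)]
  -- T solves 2000 exp(-1/T) = ε. Half of the available parameters, [T/2, T], already gives the
  -- right order.
  set T := (Real.log 2000 - Real.log ε)⁻¹ with hT
  have hden : 0 < Real.log 2000 - Real.log ε := by linarith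
  have hT0 : 0 < T := inv_pos.2 hden
  have hTA : (A * -Real.log ε)⁻¹ ≤ T := by
    rw [hT]
    gcongr
    have : Real.log 2000 ≤ Real.log 2000 / Real.log 2 * -Real.log ε := by
      rw [div_mul_eq_mul_div, le_div_iff₀ h2]
      gcongr
    rw [hA]
    linarith
  have hTpi : T < Real.pi := by
    have h1 : 1 ≤ Real.log 2000 := by
      rw [Real.le_log_iff_exp_le (by norm_num)]
      linarith [Real.exp_one_lt_d9]
    have : T ≤ 1 := inv_le_one_of_one_le₀ (by linarith)
    linarith [Real.pi_gt_three]
  have hsub : Set.Icc (T / 2) T ⊆ Set.Ioo 0 Real.pi := fun t ht =>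
    ⟨by linarith [ht.1], by linarith [ht.2]⟩
  have hlay : point₁ '' Set.Icc (T / 2) T ⊆ layer origin₁ 1 ε := by
    rintro _ ⟨t, ht, rfl⟩
    refine point₁_mem_layer (hsub ht) ?_
    have h0 : 0 < t := (hsub ht).1
    have h1 : 1 / T ≤ 1 / t := one_div_le_one_div_of_le h0 ht.2
    have h3 : 1 / T = Real.log 2000 - Real.log ε := by rw [hT, one_div, inv_inv]
    calc 2000 * Real.exp (-(1 / t)) ≤ 2000 * Real.exp (-(1 / T)) := by gcongr
      _ = ε := by
        rw [h3, neg_sub, Real.exp_sub, Real.exp_log hε, Real.exp_log (by norm_num)]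
        ring
  refine le_trans ?_ (measure_mono hlay)
  have hconn : IsPreconnected (point₁ '' Set.Icc (T / 2) T) :=
    isPreconnected_Icc.image _ (continuousOn_point₁.mono hsub)
  refine le_trans ?_ (ofReal_dist_le_hausdorffMeasure hconn
    ⟨T, ⟨by linarith, le_rfl⟩, rfl⟩ ⟨T / 2, ⟨le_rfl, by linarith⟩, rfl⟩)
  apply ENNReal.ofReal_le_ofReal
  refine le_trans ?_ (hl T (hsub ⟨by linarith, le_rfl⟩) (T / 2) (hsub ⟨le_rfl, by linarith⟩))
  rw [abs_of_pos (by linarith)]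
  calc k / (2 * A) / -Real.log ε = k * ((A * -Real.log ε)⁻¹ / 2) := by
        have : -Real.log ε ≠ 0 := by linarith
        field_simp
    _ ≤ k * (T - T / 2) := by
        gcongr
        linarith

/-- Taking ε = exp(-n) would give c/n ≤ C K exp(-η n) for all n ≥ 1. -/
theorem not_layerDecayOnBall (η : ℝ) (C : ℝ≥0) (hη : 0 < η) :
    ¬ LayerDecayOnBall length₁ origin₁ 1 η C := by
  intro h
  obtain ⟨c, hc, hlay⟩ := exists_le_length₁_layer
  obtain ⟨K, hK, hball⟩ := exists_length₁_ball_le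
  have hle : ∀ n : ℝ, 1 ≤ n → c ≤ C * K * (n * Real.exp (-(η * n))) := by
    intro n hn
    have hpos := Real.exp_pos (-n)
    have hhalf : Real.exp (-n) ≤ 1 / 2 := by
      rw [Real.exp_neg, one_div]
      gcongr
      linarith [Real.add_one_le_exp n]
    have h1 := (hlay _ hpos hhalf).trans (h _ hpos)
    rw [Real.log_exp, abs_neg, abs_of_pos (by linarith), div_one, ← Real.exp_mul,
      ← ENNReal.ofReal_coe_nnreal] at h1
    have h2 := h1.trans (mul_le_mul' le_rfl (hball origin₁ 1 one_pos))
    rw [← ENNReal.ofReal_mul (by positivity), ← ENNReal.ofReal_mul (by positivity),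
      ENNReal.ofReal_le_ofReal_iff (by positivity), div_le_iff₀ (by linarith)] at h2
    refine h2.trans (le_of_eq ?_)
    rw [show -n * η = -(η * n) by ring]
    ring
  have hlim : Filter.Tendsto (fun n : ℝ => C * K * (n * Real.exp (-(η * n)))) Filter.atTop
      (nhds 0) := by
    have h1 := (Real.tendsto_pow_mul_exp_neg_atTop_nhds_zero 1).comp
      (Filter.tendsto_id.const_mul_atTop hη)
    have h2 := h1.const_mul (C * K / η)
    rw [mul_zero] at h2
    refine h2.congr fun n => ?_
    simp only [Function.comp_apply, id, pow_one]
    field_simp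
  have := ge_of_tendsto hlim ((Filter.eventually_ge_atTop 1).mono hle)
  linarith

/-! ### Failure of the Hardy inequality on the unit ball -/

/-- The derivative of `param` has size 1/(u q(u)²) with q(u) = 1/π + ln u. On [N, 4N] the factor u
varies by at most 4 and, as N ≥ 2, q by at most 3; hence 36 = 4 · 3². -/
theorem exists_param_bounds {N : ℝ} (hN : 2 ≤ N) : ∃ a : ℝ, 0 < a ∧
    ∀ u ∈ Set.Icc N (4 * N), ∀ w ∈ Set.Icc N (4 * N),
      a / 36 * |u - w| ≤ |param u - param w| ∧ |param u - param w| ≤ a * |u - w| := by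
  have hpi := Real.pi_pos
  have hq := denominator_pos (u := N) (by linarith)
  have hq1 : Real.log 4 ≤ 2 * (1 / Real.pi + Real.log N) := by
    have h1 : Real.log 4 = 2 * Real.log 2 := by
      rw [← Real.log_rpow (by norm_num)]
      norm_num
    have h2 : Real.log 2 ≤ Real.log N := Real.log_le_log (by norm_num) hN
    have : 0 < 1 / Real.pi := by positivity
    linarith
  set q := 1 / Real.pi + Real.log N with hqdef
  refine ⟨1 / (N * (q * q)), by positivity, ?_⟩
  have key : ∀ u ∈ Set.Icc N (4 * N), ∀ w ∈ Set.Icc N (4 * N), u ≤ w →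
      1 / (N * (q * q)) / 36 * |u - w| ≤ |param u - param w| ∧
        |param u - param w| ≤ 1 / (N * (q * q)) * |u - w| := by
    intro u hu w hw huw
    have hu0 : 0 < u := by linarith [hu.1]
    have hw0 : 0 < w := by linarith [hw.1]
    have hdu : ∀ v ∈ Set.Icc N (4 * N),
        q ≤ 1 / Real.pi + Real.log v ∧ 1 / Real.pi + Real.log v ≤ 3 * q := by
      intro v hv
      have h1 : Real.log N ≤ Real.log v := Real.log_le_log (by linarith) hv.1
      have h2 : Real.log v ≤ Real.log (4 * N) := Real.log_le_log (by linarith [hv.1]) hv.2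
      rw [Real.log_mul (by norm_num) (by linarith)] at h2
      constructor <;> linarith
    obtain ⟨hu1, hu2⟩ := hdu u hu
    obtain ⟨hw1, hw2⟩ := hdu w hw
    have hpos : 0 < w / u := div_pos hw0 hu0
    have hl1 : Real.log (w / u) ≤ (w - u) / N := by
      refine (Real.log_le_sub_one_of_pos hpos).trans ?_
      rw [div_sub_one hu0.ne']
      exact div_le_div_of_nonneg_left (by linarith) (by linarith) hu.1
    have hl2 : (w - u) / (4 * N) ≤ Real.log (w / u) := by
      refine le_trans ?_ (Real.one_sub_inv_le_log_of_pos hpos)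
      rw [inv_div, one_sub_div hw0.ne']
      exact div_le_div_of_nonneg_left (by linarith) hw0 hw.2
    have hl0 : 0 ≤ (w - u) / (4 * N) := div_nonneg (by linarith) (by linarith)
    have hparam := param_sub_param (u := u) (w := w) (by linarith [hu.1]) (by linarith [hw.1])
    have hnn : 0 ≤ param u - param w := by
      rw [hparam]
      exact div_nonneg (hl0.trans hl2) (mul_nonneg (by linarith) (by linarith))
    rw [abs_of_nonneg hnn, abs_sub_comm u w, abs_of_nonneg (sub_nonneg.2 huw), hparam]
    have hN0 : 0 < N := by linarith
    constructor
    · calc 1 / (N * (q * q)) / 36 * (w - u) = (w - u) / (4 * N) / (3 * q * (3 * q)) := by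
            field_simp
            ring
        _ ≤ _ := div_le_div₀ (hl0.trans hl2) hl2 (mul_pos (by linarith) (by linarith))
          (mul_le_mul hu2 hw2 (by linarith) (by linarith))
    · calc _ ≤ (w - u) / N / (q * q) :=
          div_le_div₀ (div_nonneg (by linarith) hN0.le) hl1 (by positivity)
            (mul_le_mul hu1 hw1 hq.le (by linarith))
        _ = _ := by field_simp
  intro u hu w hw
  rcases le_total u w with h | h
  · exact key u hu w hw h
  · rw [abs_sub_comm u w, abs_sub_comm (param u)]
    exact key w hw u hu h

/-- On `[N, 4N]` the reparametrized curve is bi-Lipschitz up to a scaling factor `a`,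
uniformly in `N`. -/
theorem exists_dist_point₁_param_bounds : ∃ k L : ℝ, 0 < k ∧ 0 < L ∧ ∀ N : ℝ, 2 ≤ N →
    ∃ a : ℝ, 0 < a ∧ ∀ u ∈ Set.Icc N (4 * N), ∀ w ∈ Set.Icc N (4 * N),
      k * a * |u - w| ≤ dist (point₁ (param u)) (point₁ (param w)) ∧
        dist (point₁ (param u)) (point₁ (param w)) ≤ L * a * |u - w| := by
  obtain ⟨k, hk, hl⟩ := exists_mul_abs_sub_le_dist_point₁
  refine ⟨k / 36, 17, by positivity, by norm_num, fun N hN => ?_⟩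
  obtain ⟨a, ha, hb⟩ := exists_param_bounds hN
  refine ⟨a, ha, fun u hu w hw => ?_⟩
  have hu' := param_mem_Ioo (u := u) (by linarith [hu.1])
  have hw' := param_mem_Ioo (u := w) (by linarith [hw.1])
  obtain ⟨h1, h2⟩ := hb u hu w hw
  constructor
  · refine le_trans ?_ (hl _ hu' _ hw')
    calc k / 36 * a * |u - w| = k * (a / 36 * |u - w|) := by ring
      _ ≤ _ := by gcongr
  · refine (dist_point₁_le hu' hw').trans ?_
    calc 17 * |param u - param w| ≤ 17 * (a * |u - w|) := by gcongr
      _ = _ := by ring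

/-- The arc of `X₁` on which `exp (1 / t - 1 / π)` ranges over `[p, q]`. -/
def arc₁ (p q : ℝ) : Set X₁ := (fun u => point₁ (param u)) '' Set.Icc p q

section Arcs

variable {N k L a : ℝ}

theorem ofReal_le_length₁_arc₁
    (hb : ∀ u ∈ Set.Icc N (4 * N), ∀ w ∈ Set.Icc N (4 * N),
      k * a * |u - w| ≤ dist (point₁ (param u)) (point₁ (param w)) ∧
        dist (point₁ (param u)) (point₁ (param w)) ≤ L * a * |u - w|)
    (hcont : ContinuousOn (fun u => point₁ (param u)) (Set.Icc N (4 * N)))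
    {p q : ℝ} (hpq : p ≤ q) (hp : N ≤ p) (hq : q ≤ 4 * N) :
    ENNReal.ofReal (k * a * (q - p)) ≤ length₁ (arc₁ p q) := by
  have hconn : IsPreconnected (arc₁ p q) :=
    isPreconnected_Icc.image _ (hcont.mono (Set.Icc_subset_Icc hp hq))
  refine le_trans ?_ (ofReal_dist_le_hausdorffMeasure hconn
    ⟨q, ⟨hpq, le_rfl⟩, rfl⟩ ⟨p, ⟨le_rfl, hpq⟩, rfl⟩)
  apply ENNReal.ofReal_le_ofReal
  have := (hb q ⟨hp.trans hpq, hq⟩ p ⟨hp, hpq.trans hq⟩).1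
  rwa [abs_of_nonneg (sub_nonneg.2 hpq)] at this

theorem measurableSet_arc₁
    (hcont : ContinuousOn (fun u => point₁ (param u)) (Set.Icc N (4 * N)))
    {p q : ℝ} (hp : N ≤ p) (hq : q ≤ 4 * N) : MeasurableSet (arc₁ p q) :=
  (isCompact_Icc.image_of_continuousOn
    (hcont.mono (Set.Icc_subset_Icc hp hq))).isClosed.measurableSet

end Arcs

theorem disjoint_arc₁ {p q p' q' : ℝ} (hp : 1 < p) (hp' : 1 < p')
    (h : Disjoint (Set.Icc p q) (Set.Icc p' q')) : Disjoint (arc₁ p q) (arc₁ p' q') := by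
  obtain ⟨k, hk, hl⟩ := exists_mul_abs_sub_le_dist_point₁
  refine Set.disjoint_left.2 ?_
  rintro _ ⟨u, hu, rfl⟩ ⟨w, hw, hwu⟩
  have h1 := hl _ (param_mem_Ioo (hp'.trans_le hw.1)) _ (param_mem_Ioo (hp.trans_le hu.1))
  simp only at hwu
  rw [hwu, dist_self] at h1
  have h2 : param w = param u := by
    have := abs_nonneg (param w - param u)
    have : |param w - param u| = 0 := by nlinarith
    linarith [abs_eq_zero.1 this]
  rcases lt_trichotomy u w with h3 | h3 | h3
  · exact (param_lt_param (hp.le.trans hu.1) h3).ne h2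
  · exact Set.disjoint_left.1 h hu (h3 ▸ hw)
  · exact (param_lt_param (hp'.le.trans hw.1) h3).ne' h2

theorem disjoint_arc₁_nat {b c : ℝ} (hb : 0 ≤ b) (hc : c - b < 2) {i j : ℕ} (hi : 1 ≤ i)
    (hj : 1 ≤ j) (hij : i ≠ j) :
    Disjoint (arc₁ (2 * i + b) (2 * i + c)) (arc₁ (2 * j + b) (2 * j + c)) := by
  have hi' : (1 : ℝ) ≤ i := by exact_mod_cast hi
  have hj' : (1 : ℝ) ≤ j := by exact_mod_cast hj
  refine disjoint_arc₁ (by linarith) (by linarith) (Set.disjoint_left.2 ?_)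
  rintro x ⟨h1, h2⟩ ⟨h3, h4⟩
  rcases lt_or_gt_of_ne hij with h | h
  · have : (i : ℝ) + 1 ≤ j := by exact_mod_cast h
    linarith
  · have : (j : ℝ) + 1 ≤ i := by exact_mod_cast h
    linarith

theorem arc₁_subset_ball {j : ℕ} {b c : ℝ} (hb : 1 < b) (hc : c < 2) :
    arc₁ (2 * j + b) (2 * j + c) ⊆ Metric.ball origin₁ 1 := by
  rintro _ ⟨u, ⟨h1, h2⟩, rfl⟩
  have hj : (0 : ℝ) ≤ j := j.cast_nonneg
  exact point₁_param_mem_ball (by linarith) (sin_pi_mul_neg j (by linarith) (by linarith))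

theorem arc₁_subset_annulus {j : ℕ} (hj : 1 ≤ j) :
    arc₁ (2 * j + 0) (2 * j + 1) ⊆ Metric.ball origin₁ (2 * 1) \ Metric.ball origin₁ 1 := by
  rintro _ ⟨u, ⟨h1, h2⟩, rfl⟩
  have hj : (1 : ℝ) ≤ j := by exact_mod_cast hj
  have hu : 1 < u := by linarith
  refine ⟨?_, point₁_param_notMem_ball hu (sin_pi_mul_nonneg j (by linarith) (by linarith))⟩
  obtain ⟨δ, hδ, hb⟩ := exists_abs_eps₁_le
  rw [Metric.mem_ball, dist_point₁_origin₁ (param_mem_Ioo hu)]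
  linarith [(abs_le.1 (hb _ (param_mem_Ioo hu))).2]

/-- The Hardy inequality for indicator functions. -/
theorem HardyOnBall.lintegral_indicator_le {X : Type*} [MetricSpace X] [MeasurableSpace X]
    [BorelSpace X] {μ : Measure X} {z : X} {r ν : ℝ} {C : ℝ≥0} (h : HardyOnBall μ z r ν C)
    (hν : 1 < ν) {F G : Set X} (hF : MeasurableSet F) (hG : MeasurableSet G)
    (hFB : F ⊆ Metric.ball z r) (hGB : G ⊆ Metric.ball z (2 * r) \ Metric.ball z r)
    {V : ℝ≥0∞} (hV : V ≠ ∞) (hFV : μ F ≤ V) (hGV : μ G ≤ V) :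
    ∫⁻ y in F, ∫⁻ x in G, (vol μ x y)⁻¹ ∂μ ∂μ ≤ C * V := by
  have hν' : 0 < ν / (ν - 1) := div_pos (by linarith) (by linarith)
  have h1 := h (F.indicator fun _ => 1) (G.indicator fun _ => 1)
    (Set.support_indicator_subset.trans hFB) (Set.support_indicator_subset.trans hGB)
    (memLp_indicator_const _ hF 1 (Or.inr (ne_top_of_le_ne_top hV hFV)))
    (memLp_indicator_const _ hG 1 (Or.inr (ne_top_of_le_ne_top hV hGV)))
  rw [eLpNorm_indicator_const hF (by simp; linarith) ENNReal.ofReal_ne_top,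
    eLpNorm_indicator_const hG (by simpa using hν') ENNReal.ofReal_ne_top,
    ENNReal.toReal_ofReal (by linarith), ENNReal.toReal_ofReal hν'.le, enorm_one, one_mul,
    one_mul, mul_assoc] at h1
  -- The exponents are conjugate, so a common bound V for both measures removes the dependence on ν.
  have h2 : μ F ^ (1 / ν) * μ G ^ (1 / (ν / (ν - 1))) ≤ V := by
    calc μ F ^ (1 / ν) * μ G ^ (1 / (ν / (ν - 1)))
        ≤ V ^ (1 / ν) * V ^ (1 / (ν / (ν - 1))) := by gcongr
      _ = V := by
        rw [← ENNReal.rpow_add_of_nonneg _ _ (by positivity) (by positivity)]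
        have : 1 / ν + 1 / (ν / (ν - 1)) = 1 := by
          have : ν - 1 ≠ 0 := by linarith
          field_simp
          ring
        rw [this, ENNReal.rpow_one]
  refine le_trans ?_ (h1.trans (mul_le_mul' le_rfl h2))
  refine le_trans (setLIntegral_mono' hF fun y hy => ?_) (lintegral_mono_set hFB)
  refine le_trans (setLIntegral_mono' hG fun x hx => ?_) (lintegral_mono_set hGB)
  rw [Set.indicator_of_mem hy, Set.indicator_of_mem hx, one_mul, enorm_one, one_div]

/-- Both the scale a and the number m of pieces cancel; this makes the bound on S uniform in m. -/
theorem le_of_scaled_le {k K L a m S C : ℝ} (hk : 0 < k) (hK : 0 < K) (hL : 0 < L) (ha : 0 < a)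
    (hm : 0 < m) (h : m * (k / (2 * K * L) * S * (k * a / 2)) ≤ C * (L * a * (6 * m))) :
    S ≤ C * (24 * K * L ^ 2 / k ^ 2) := by
  have hfac : 0 ≤ 4 * K * L / (k ^ 2 * a * m) := by positivity
  calc S = m * (k / (2 * K * L) * S * (k * a / 2)) * (4 * K * L / (k ^ 2 * a * m)) := by
        field_simp
        norm_num
    _ ≤ C * (L * a * (6 * m)) * (4 * K * L / (k ^ 2 * a * m)) :=
        mul_le_mul_of_nonneg_right h hfac
    _ = C * (24 * K * L ^ 2 / k ^ 2) := by
        field_simp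
        ring

/-- Serves both integrations: the inner one with e l = i + l, which orders outer pieces by index
gap, and the outer one with e the identity. -/
theorem sum_mul_le_lintegral_biUnion {X ι κ : Type*} [MeasurableSpace X] {μ : Measure X}
    {t : Finset ι} {u : Finset κ} {B : ι → Set X} {e : κ → ι} {c : κ → ℝ≥0∞} {v : ℝ≥0∞}
    {f : X → ℝ≥0∞} (hBm : ∀ j ∈ t, MeasurableSet (B j)) (hBd : (t : Set ι).PairwiseDisjoint B)
    (he : Function.Injective e) (het : ∀ l ∈ u, e l ∈ t)
    (hf : ∀ l ∈ u, ∀ x ∈ B (e l), c l ≤ f x) (hv : ∀ j ∈ t, v ≤ μ (B j)) :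
    ∑ l ∈ u, c l * v ≤ ∫⁻ x in ⋃ j ∈ t, B j, f x ∂μ := by
  have hsub : u.map ⟨e, he⟩ ⊆ t := by
    intro j hj
    obtain ⟨l, hl, rfl⟩ := Finset.mem_map.1 hj
    exact het l hl
  rw [lintegral_biUnion_finset hBd hBm]
  refine le_trans ?_ (Finset.sum_le_sum_of_subset hsub)
  rw [Finset.sum_map]
  refine Finset.sum_le_sum fun l hl => ?_
  refine le_trans ?_ (setLIntegral_mono' (hBm _ (het l hl)) (hf l hl))
  rw [setLIntegral_const]
  exact mul_le_mul' le_rfl (hv _ (het l hl))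

theorem sum_ofReal_eq {k K L a : ℝ} (hk : 0 < k) (hK : 0 < K) (hL : 0 < L) (ha : 0 < a) (m : ℕ) :
    ∑ l ∈ Finset.range m,
        (ENNReal.ofReal (K * (L * a * (2 * ((l : ℝ) + 1)))))⁻¹ * ENNReal.ofReal (k * a) =
      ENNReal.ofReal (k / (2 * K * L) * ∑ l ∈ Finset.range m, (1 : ℝ) / (l + 1)) := by
  rw [Finset.mul_sum, ENNReal.ofReal_sum_of_nonneg fun l _ => by positivity]
  refine Finset.sum_congr rfl fun l _ => ?_
  rw [← ENNReal.ofReal_inv_of_pos (by positivity), ← ENNReal.ofReal_mul (by positivity)]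
  congr 1
  field_simp

theorem not_hardyOnBall (ν : ℝ) (C : ℝ≥0) (hν : 1 < ν) :
    ¬ HardyOnBall length₁ origin₁ 1 ν C := by
  intro hH
  obtain ⟨k, L, hk, hL, hN⟩ := exists_dist_point₁_param_bounds
  obtain ⟨K, hK, hball⟩ := exists_length₁_ball_le
  have main : ∀ m : ℕ, 1 ≤ m →
      ∑ i ∈ Finset.range m, (1 : ℝ) / (i + 1) ≤ C * (24 * K * L ^ 2 / k ^ 2) := by
    intro m hm
    have hm' : (1 : ℝ) ≤ m := by exact_mod_cast hm
    obtain ⟨a, ha, hb⟩ := hN (2 * m) (by linarith)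
    have hcont : ContinuousOn (fun u => point₁ (param u))
        (Set.Icc (2 * (m : ℝ)) (4 * (2 * m))) := by
      have h : LipschitzOnWith (L * a).toNNReal (fun u => point₁ (param u))
          (Set.Icc (2 * (m : ℝ)) (4 * (2 * m))) := by
        refine LipschitzOnWith.of_dist_le_mul fun t ht s hs => ?_
        rw [Real.coe_toNNReal _ (by positivity)]
        exact (hb t ht s hs).2
      exact h.continuousOn
    have range_of_mem : ∀ j ∈ Finset.Ico m (3 * m), 1 ≤ j ∧ 2 * (m : ℝ) ≤ 2 * j ∧
        2 * (j : ℝ) + 2 ≤ 4 * (2 * m) := by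
      intro j hj
      rw [Finset.mem_Ico] at hj
      have h1 : (m : ℝ) ≤ j := by exact_mod_cast hj.1
      have h2 : (j : ℝ) ≤ 3 * m := by exact_mod_cast hj.2.le
      exact ⟨hm.trans hj.1, by linarith, by linarith⟩
    have hIco : Finset.Ico m (2 * m) ⊆ Finset.Ico m (3 * m) :=
      Finset.Ico_subset_Ico_right (by omega)
    -- Middle halves of the inner pieces: compact, and strictly inside the circle. Letting j run up
    -- to 3m keeps i + l in range for all i < 2m and l < m.
    set A : ℕ → Set X₁ := fun i => arc₁ (2 * i + 5 / 4) (2 * i + 7 / 4) with hA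
    set B : ℕ → Set X₁ := fun j => arc₁ (2 * j + 0) (2 * j + 1) with hB
    have hAm : ∀ i ∈ Finset.Ico m (2 * m), MeasurableSet (A i) := fun i hi => by
      obtain ⟨-, h1, h2⟩ := range_of_mem i (hIco hi)
      exact measurableSet_arc₁ hcont (by linarith) (by linarith)
    have hBm : ∀ j ∈ Finset.Ico m (3 * m), MeasurableSet (B j) := fun j hj => by
      obtain ⟨-, h1, h2⟩ := range_of_mem j hj
      exact measurableSet_arc₁ hcont (by linarith) (by linarith)
    have hAd : (Finset.Ico m (2 * m) : Set ℕ).PairwiseDisjoint A := fun i hi j hj hij =>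
      disjoint_arc₁_nat (by norm_num) (by norm_num) (range_of_mem i (hIco hi)).1
        (range_of_mem j (hIco hj)).1 hij
    have hBd : (Finset.Ico m (3 * m) : Set ℕ).PairwiseDisjoint B := fun i hi j hj hij =>
      disjoint_arc₁_nat le_rfl (by norm_num) (range_of_mem i hi).1 (range_of_mem j hj).1 hij
    have hAl : ∀ i ∈ Finset.Ico m (2 * m), ENNReal.ofReal (k * a / 2) ≤ length₁ (A i) := by
      intro i hi
      obtain ⟨-, h1, h2⟩ := range_of_mem i (hIco hi)
      convert ofReal_le_length₁_arc₁ hb hcont (p := 2 * i + 5 / 4) (q := 2 * i + 7 / 4)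
        (by linarith) (by linarith) (by linarith) using 2
      ring
    have hBl : ∀ j ∈ Finset.Ico m (3 * m), ENNReal.ofReal (k * a) ≤ length₁ (B j) := by
      intro j hj
      obtain ⟨-, h1, h2⟩ := range_of_mem j hj
      convert ofReal_le_length₁_arc₁ hb hcont (p := 2 * j + 0) (q := 2 * j + 1)
        (by linarith) (by linarith) (by linarith) using 2
      ring
    have hV : length₁ (arc₁ (2 * m) (4 * (2 * m))) ≤ ENNReal.ofReal (L * a * (6 * m)) := by
      refine (hausdorffMeasure_image_le_ofReal (fun t ht s hs => (hb t ht s hs).2)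
        subset_rfl).trans (le_of_eq ?_)
      congr 1
      ring
    have hAV : ⋃ i ∈ Finset.Ico m (2 * m), A i ⊆ arc₁ (2 * m) (4 * (2 * m)) := by
      refine Set.iUnion₂_subset fun i hi => Set.image_mono ?_
      obtain ⟨-, h1, h2⟩ := range_of_mem i (hIco hi)
      exact Set.Icc_subset_Icc (by linarith) (by linarith)
    have hBV : ⋃ j ∈ Finset.Ico m (3 * m), B j ⊆ arc₁ (2 * m) (4 * (2 * m)) := by
      refine Set.iUnion₂_subset fun j hj => Set.image_mono ?_
      obtain ⟨-, h1, h2⟩ := range_of_mem j hj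
      exact Set.Icc_subset_Icc (by linarith) (by linarith)
    have hvol : ∀ i ∈ Finset.Ico m (2 * m), ∀ l ∈ Finset.range m, ∀ y ∈ A i, ∀ x ∈ B (i + l),
        (ENNReal.ofReal (K * (L * a * (2 * (l + 1)))))⁻¹ ≤ (vol length₁ x y)⁻¹ := by
      intro i hi l hl y hy x hx
      have hj : i + l ∈ Finset.Ico m (3 * m) := by
        simp only [Finset.mem_Ico, Finset.mem_range] at hi hl ⊢
        omega
      -- The upper bound on the length of a ball needs a positive radius.
      have hxy : x ≠ y := fun h => by
        subst h
        exact (arc₁_subset_annulus (range_of_mem _ hj).1 hx).2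
          (arc₁_subset_ball (by norm_num) (by norm_num) hy)
      refine ENNReal.inv_le_inv.2 ((hball x _ (dist_pos.2 hxy)).trans ?_)
      apply ENNReal.ofReal_le_ofReal
      obtain ⟨-, h1, h2⟩ := range_of_mem i (hIco hi)
      obtain ⟨-, h3, h4⟩ := range_of_mem _ hj
      obtain ⟨u, ⟨hu1, hu2⟩, rfl⟩ := hy
      obtain ⟨w, ⟨hw1, hw2⟩, rfl⟩ := hx
      have hd := (hb w ⟨by linarith, by linarith⟩ u ⟨by linarith, by linarith⟩).2
      -- Here w - u lies between 2l - 7/4 and 2l - 1/4; the cruder bound yields the terms of the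
      -- harmonic series.
      have hwu : |w - u| ≤ 2 * (l + 1) := by
        push_cast at hw1 hw2
        have : (0 : ℝ) ≤ l := l.cast_nonneg
        rw [abs_le]
        constructor <;> linarith
      refine mul_le_mul_of_nonneg_left (hd.trans ?_) hK.le
      gcongr
    have hinner : ∀ i ∈ Finset.Ico m (2 * m), ∀ y ∈ A i,
        ENNReal.ofReal (k / (2 * K * L) * ∑ l ∈ Finset.range m, (1 : ℝ) / (l + 1)) ≤
          ∫⁻ x in ⋃ j ∈ Finset.Ico m (3 * m), B j, (vol length₁ x y)⁻¹ ∂length₁ := by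
      intro i hi y hy
      have hmem : ∀ l ∈ Finset.range m, i + l ∈ Finset.Ico m (3 * m) := by
        intro l hl
        simp only [Finset.mem_range, Finset.mem_Ico] at hi hl ⊢
        omega
      rw [← sum_ofReal_eq hk hK hL ha]
      exact sum_mul_le_lintegral_biUnion hBm hBd (add_right_injective i) hmem
        (fun l hl x hx => hvol i hi l hl y hy x hx) hBl
    have hlow := sum_mul_le_lintegral_biUnion hAm hAd Function.injective_id
      (fun _ => id) hinner hAl
    rw [Finset.sum_const, Nat.card_Ico, show 2 * m - m = m by omega, nsmul_eq_mul] at hlow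
    have hup := hH.lintegral_indicator_le hν (Finset.measurableSet_biUnion _ hAm)
      (Finset.measurableSet_biUnion _ hBm)
      (Set.iUnion₂_subset fun i _ => arc₁_subset_ball (by norm_num) (by norm_num))
      (Set.iUnion₂_subset fun j hj => arc₁_subset_annulus (range_of_mem j hj).1)
      ENNReal.ofReal_ne_top ((measure_mono hAV).trans hV) ((measure_mono hBV).trans hV)
    have hfin := hlow.trans hup
    rw [← ENNReal.ofReal_mul' (by positivity), ← ENNReal.ofReal_natCast,
      ← ENNReal.ofReal_mul (by positivity), ← ENNReal.ofReal_coe_nnreal,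
      ← ENNReal.ofReal_mul C.coe_nonneg, ENNReal.ofReal_le_ofReal_iff
        (mul_nonneg C.coe_nonneg (by positivity))] at hfin
    exact le_of_scaled_le hk hK hL ha (by linarith) hfin
  obtain ⟨m, hm1, hm2⟩ := ((Real.tendsto_sum_range_one_div_nat_succ_atTop.eventually_gt_atTop
    (C * (24 * K * L ^ 2 / k ^ 2))).and (Filter.eventually_ge_atTop 1)).exists
  exact absurd (main m hm2) (not_le.2 hm1)

end HomogeneousType

theorem mainTheorem5 :
    HomogeneousType.IsHomogeneousType HomogeneousType.length₁ ∧
    (∃ c : ℝ, 0 < c ∧ ∀ ε : ℝ, 0 < ε → ε ≤ 1 / 2 →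
      ENNReal.ofReal (c / |Real.log ε|) ≤
        HomogeneousType.length₁ (HomogeneousType.layer HomogeneousType.origin₁ 1 ε)) ∧
    (∀ (η : ℝ) (C : ℝ≥0), 0 < η →
      ¬ HomogeneousType.LayerDecayOnBall HomogeneousType.length₁ HomogeneousType.origin₁ 1 η C) ∧
    ¬ HomogeneousType.LayerDecay HomogeneousType.length₁ ∧
    (∀ (ν : ℝ) (C : ℝ≥0), 1 < ν →
      ¬ HomogeneousType.HardyOnBall HomogeneousType.length₁ HomogeneousType.origin₁ 1 ν C) ∧
    (∀ ν : ℝ, 1 < ν → ¬ HomogeneousType.HardyForExponent HomogeneousType.length₁ ν) ∧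
    ¬ HomogeneousType.HardyProperty HomogeneousType.length₁ := by
  have hexp : ∀ ν : ℝ, 1 < ν →
      ¬ HomogeneousType.HardyForExponent HomogeneousType.length₁ ν := fun ν hν ⟨C, hC⟩ =>
    HomogeneousType.not_hardyOnBall ν C hν (hC _ _ one_pos)
  exact ⟨HomogeneousType.isHomogeneousType_length₁, HomogeneousType.exists_le_length₁_layer,
    HomogeneousType.not_layerDecayOnBall,
    fun ⟨η, hη, C, hC⟩ => HomogeneousType.not_layerDecayOnBall η C hη (hC _ _ one_pos),
    HomogeneousType.not_hardyOnBall, hexp, fun h => hexp 2 one_lt_two (h 2 one_lt_two)⟩
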